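/- Let $X$ be a Riemann surface (a connected Hausdorff one-dimensional complex manifold), let $\Omega\subseteq X$ be open, and let $d\sigma^2$ be a conformal metric on $\Omega$: in every local holomorphic coordinate $z$ it has the form $d\sigma^2=e^{2\varphi}|dz|^2$ on the part of the coordinate domain in $\Omega$, with $\varphi$ real-valued of class $C^2$. Assume that $d\sigma^2$ is flat, i.e. that its Gauss curvature $-e^{-2\varphi}\Delta\varphi$ vanishes on $\Omega$, and that its total area, $\int_\Omega e^{2\varphi}\,dx\,dy$ computed through local coordinates $z = x+iy$, is finite. Let $p\in X$ be an isolated singularity of $d\sigma^2$, i.e. $p\notin\Omega$, but $\Omega$ contains a punctured neighbourhood of $p$. Then $p$ is a conical singularity. More precisely, there is a real number $\beta>-1$ such that: 1. $d\sigma^2$ has a conical singularity at $p$ with cone angle $2\pi\alpha$, where $\alpha=\beta+1>0$: in a neighbourhood of $p$ there is a holomorphic coordinate $z$ with $z(p)=0$ in which $d\sigma^2=e^{2\varphi}|dz|^2$ away from $p$, and $\varphi-(\alpha-1)\ln|z|$ extends to a continuous function on the whole neighbourhood; 2. in a neighbourhood of $p$ there is a holomorphic coordinate $z$ with $z(p)=0$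 in which $$d\sigma^2=(\beta+1)^2|z|^{2\beta}|dz|^2\qquad (z\neq0).$$ -/

import Mathlib

open scoped Manifold ContDiff Topology ENNReal

noncomputable section

/-- A local holomorphic coordinate on a Riemann surface `X`: a homeomorphism between open subsets
of `X` and `ℂ` that belongs to the maximal holomorphic atlas. -/
def IsHolCoord {X : Type*} [TopologicalSpace X] [ChartedSpace ℂ X]
    (e : OpenPartialHomeomorph X ℂ) : Prop :=
  e ∈ IsManifold.maximalAtlas 𝓘(ℂ) ω X

/-- A conformal metric on the open subset `Ω` of a Riemann surface `X`: in every local holomorphic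
coordinate `z = e` it is `exp (2 φ) |dz|²` on `e (Ω)`, where `φ = logDensity e` is `C²` (the
regularity that curvature needs), and these expressions agree under changes of coordinates. The
values of `logDensity e` outside `e (Ω)`, or for `e` not a holomorphic coordinate, play no role. -/
structure ConformalMetric (X : Type*) [TopologicalSpace X] [ChartedSpace ℂ X]
    (Ω : TopologicalSpace.Opens X) where
  logDensity : OpenPartialHomeomorph X ℂ → ℂ → ℝ
  contDiffOn_logDensity : ∀ e : OpenPartialHomeomorph X ℂ, IsHolCoord e →
    ContDiffOn ℝ 2 (logDensity e) (e.target ∩ e.symm ⁻¹' (Ω : Set X))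
  /-- With `z = e x` and `w = e' x` this says `exp (2 φ) = exp (2 φ') |dw/dz|²`. -/
  logDensity_change : ∀ e e' : OpenPartialHomeomorph X ℂ, IsHolCoord e → IsHolCoord e' →
    ∀ x ∈ Ω, x ∈ e.source → x ∈ e'.source →
      logDensity e (e x) =
        logDensity e' (e' x) + Real.log ‖deriv (fun z => e' (e.symm z)) (e x)‖

namespace ConformalMetric

variable {X : Type*} [TopologicalSpace X] [ChartedSpace ℂ X] {Ω : TopologicalSpace.Opens X}

/-- The Gauss curvature `-exp (-2 φ) Δφ` of `exp (2 φ) |dz|²`, in the coordinate `e`, at `z`. -/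
def gaussCurvature (g : ConformalMetric X Ω) (e : OpenPartialHomeomorph X ℂ) (z : ℂ) : ℝ :=
  -Real.exp (-2 * g.logDensity e z) * Laplacian.laplacian (g.logDensity e) z

/-- A metric is flat if its Gauss curvature vanishes at every point of `Ω`. -/
def IsFlat (g : ConformalMetric X Ω) : Prop :=
  ∀ e : OpenPartialHomeomorph X ℂ, IsHolCoord e →
    ∀ x ∈ Ω, x ∈ e.source → g.gaussCurvature e (e x) = 0

/-- The area of a subset `B` of the domain of the coordinate `e`, computed in this coordinate. -/
def areaInCoord (g : ConformalMetric X Ω) (e : OpenPartialHomeomorph X ℂ) (B : Set X) : ℝ≥0∞ :=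
  ∫⁻ z in e '' B, ENNReal.ofReal (Real.exp (2 * g.logDensity e z))

/-- The area of the metric: the supremum of `∑ i, area (B i)` over all finite families of pairwise
disjoint measurable subsets `B i` of `Ω`, each contained in the domain of a coordinate `e i`. -/
def area (g : ConformalMetric X Ω) : ℝ≥0∞ :=
  ⨆ (n : ℕ) (e : Fin n → OpenPartialHomeomorph X ℂ) (B : Fin n → Set X)
    (_ : ∀ i, IsHolCoord (e i) ∧ B i ⊆ (Ω : Set X) ∩ (e i).source ∧
      MeasurableSet (e i '' B i))
    (_ : Pairwise fun i j => Disjoint (B i) (B j)),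
    ∑ i, g.areaInCoord (e i) (B i)

/-- `p` is an isolated singularity of a metric on `Ω`: the metric is not defined at `p`, but on a
punctured neighbourhood of `p`. -/
def IsIsolatedSingularity (_g : ConformalMetric X Ω) (p : X) : Prop :=
  p ∉ Ω ∧ (Ω : Set X) ∈ 𝓝[≠] p

/-- `e` is a coordinate centred at `p`, on whose domain the metric is defined except perhaps
at `p`. -/
def IsCoordCentredAt (_g : ConformalMetric X Ω) (e : OpenPartialHomeomorph X ℂ) (p : X) : Prop :=
  IsHolCoord e ∧ p ∈ e.source ∧ e p = 0 ∧ e.source \ {p} ⊆ (Ω : Set X)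

/-- The metric has a conical singularity at `p` with cone angle `θ = 2πα > 0`: near `p` it is
`exp (2 φ) |dz|²` in a coordinate `z` with `z p = 0`, where `φ - (α - 1) log |z|` is continuous,
i.e. extends to a continuous function `ψ` on the whole coordinate neighbourhood. -/
def HasConicalSingularity (g : ConformalMetric X Ω) (p : X) (θ : ℝ) : Prop :=
  0 < θ ∧ ∃ e : OpenPartialHomeomorph X ℂ, g.IsCoordCentredAt e p ∧
    ∃ ψ : ℂ → ℝ, ContinuousOn ψ e.target ∧
      ∀ z ∈ e.target, z ≠ 0 →
        g.logDensity e z - (θ / (2 * Real.pi) - 1) * Real.log ‖z‖ = ψ z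

/-- Near `p` the metric is `(β + 1)² |z|^(2β) |dz|²` in a coordinate `z` with `z p = 0`. -/
def HasConeNormalForm (g : ConformalMetric X Ω) (p : X) (β : ℝ) : Prop :=
  ∃ e : OpenPartialHomeomorph X ℂ, g.IsCoordCentredAt e p ∧
    ∀ z ∈ e.target, z ≠ 0 →
      Real.exp (2 * g.logDensity e z) = (β + 1) ^ 2 * ‖z‖ ^ (2 * β)

end ConformalMetric

end

/-! In a coordinate centred at `p`, flatness says that `φ` is harmonic on a punctured disc. Its
harmonic conjugate may be multivalued, but a suitable multiple of `log |z|` absorbs the period, so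
`exp φ * |z|^b = |U|` with `U` holomorphic off the origin (`exists_differentiableOn_norm_eq`).

Finite area and the submean value property bound `exp (2 φ) * |z|^2`, so `U` has no essential
singularity. Factoring out its order gives `exp φ = |z|^β |v|` with `v` holomorphic and `v 0 ≠ 0`,
and finite area then forces `β > -1` (`exists_exp_eq_norm_rpow_mul_norm`). Since `φ - β log |z| =
log |v|` is continuous, the singularity is conical.

For the normal form one wants `(w^(β+1))' = z^β v`. Writing `w^(β+1) = z^(β+1) Q` turns this into `z
Q' + (β+1) Q = v`, which has a holomorphic solution with `Q 0 ≠ 0`. Hence `w = z Q^(1/(β+1))` is a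
coordinate. -/

/-! ### Harmonic functions on a half-plane and on a punctured disc -/

theorem InnerProductSpace.HarmonicAt.comp_analyticAt {φ : ℂ → ℝ} {f : ℂ → ℂ} {z : ℂ}
    (hφ : InnerProductSpace.HarmonicAt φ (f z)) (hf : AnalyticAt ℂ f z) :
    InnerProductSpace.HarmonicAt (fun ζ => φ (f ζ)) z := by
  obtain ⟨r, hr, hball⟩ := Metric.eventually_nhds_iff_ball.1 hφ.eventually
  obtain ⟨F, hF, hFφ⟩ := InnerProductSpace.HarmonicOnNhd.exists_analyticOnNhd_ball_re_eq
    (f := φ) (z := f z) (R := r) hball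
  have h1 : InnerProductSpace.HarmonicAt (fun ζ => (F (f ζ)).re) z :=
    ((hF _ (Metric.mem_ball_self hr)).comp hf).harmonicAt_re
  refine (InnerProductSpace.harmonicAt_congr_nhds ?_).1 h1
  filter_upwards [hf.continuousAt.preimage_mem_nhds (Metric.ball_mem_nhds _ hr)] with ζ hζ
  exact hFφ hζ

/-- A harmonic function on the left half-plane is the real part of a holomorphic function. -/
theorem exists_re_eq_of_harmonicOnNhd_re_neg {Φ : ℂ → ℝ}
    (hΦ : InnerProductSpace.HarmonicOnNhd Φ {w : ℂ | w.re < 0}) :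
    ∃ K : ℂ → ℂ, DifferentiableOn ℂ K {w : ℂ | w.re < 0} ∧
      ∀ w : ℂ, w.re < 0 → (K w).re = Φ w := by
  have hne : ∀ ζ ∈ Metric.ball (0 : ℂ) 1, ζ - 1 ≠ 0 := by
    intro ζ hζ h
    rw [sub_eq_zero] at h
    simp [h] at hζ
  -- The Cayley map `ζ ↦ (ζ + 1) / (ζ - 1)` exchanges the unit disc and the left half-plane. It is
  -- its own inverse, so one formula serves both directions.
  have hre : ∀ ζ ∈ Metric.ball (0 : ℂ) 1, ((ζ + 1) / (ζ - 1)).re < 0 := by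
    intro ζ hζ
    have h0 := Complex.normSq_pos.2 (hne ζ hζ)
    have h1 : Complex.normSq ζ < 1 := by
      rw [Complex.normSq_eq_norm_sq]
      have : ‖ζ‖ < 1 := by simpa using hζ
      nlinarith [norm_nonneg ζ]
    rw [Complex.div_re, ← add_div]
    refine div_neg_of_neg_of_pos ?_ h0
    rw [Complex.normSq_apply] at h1
    simp only [Complex.add_re, Complex.sub_re, Complex.one_re, Complex.add_im, Complex.sub_im,
      Complex.one_im]
    nlinarith
  obtain ⟨k, hk, hkΦ⟩ := InnerProductSpace.HarmonicOnNhd.exists_analyticOnNhd_ball_re_eq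
    (f := fun ζ => Φ ((ζ + 1) / (ζ - 1))) (z := 0) (R := 1) fun ζ hζ =>
      InnerProductSpace.HarmonicAt.comp_analyticAt (f := fun ζ => (ζ + 1) / (ζ - 1))
        (hΦ _ (hre ζ hζ))
        ((analyticAt_id.add analyticAt_const).div (analyticAt_id.sub analyticAt_const) (hne ζ hζ))
  have hne' : ∀ w : ℂ, w.re < 0 → w - 1 ≠ 0 := by
    intro w hw h
    rw [sub_eq_zero] at h
    norm_num [h] at hw
  have hmem : ∀ w : ℂ, w.re < 0 → (w + 1) / (w - 1) ∈ Metric.ball (0 : ℂ) 1 := by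
    intro w hw
    have h0 : 0 < ‖w - 1‖ := norm_pos_iff.2 (hne' w hw)
    rw [mem_ball_zero_iff, norm_div, div_lt_one h0, ← sq_lt_sq₀ (norm_nonneg _) (norm_nonneg _),
      ← Complex.normSq_eq_norm_sq, ← Complex.normSq_eq_norm_sq, Complex.normSq_apply,
      Complex.normSq_apply]
    simp only [Complex.add_re, Complex.sub_re, Complex.one_re, Complex.add_im, Complex.sub_im,
      Complex.one_im]
    nlinarith
  refine ⟨fun w => k ((w + 1) / (w - 1)), fun w hw => ?_, fun w hw => ?_⟩
  · refine DifferentiableAt.differentiableWithinAt ?_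
    exact DifferentiableAt.comp (g := k) w (hk _ (hmem w hw)).differentiableAt
      ((differentiableAt_id.add_const _).div (differentiableAt_id.sub_const _) (hne' w hw))
  · have := hkΦ (hmem w hw)
    simp only at this
    rw [this]
    congr 1
    have h1 := hne' w hw
    have h2 : (w + 1) / (w - 1) - 1 ≠ 0 := hne _ (hmem w hw)
    have h3 : (w + 1) / (w - 1) - 1 = 2 / (w - 1) := by field_simp; ring
    have h4 : (w + 1) / (w - 1) + 1 = 2 * w / (w - 1) := by field_simp; ring
    rw [h3, h4]
    field_simp

/-- A harmonic function `φ` on a punctured disc is `log |U| - b log |z|` with `U` holomorphic. -/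
theorem exists_differentiableOn_norm_eq {φ : ℂ → ℝ} {R : ℝ} (hR : 0 < R)
    (hφ : InnerProductSpace.HarmonicOnNhd φ (Metric.ball 0 R \ {0})) :
    ∃ (b : ℝ) (U : ℂ → ℂ), DifferentiableOn ℂ U (Metric.ball 0 R \ {0}) ∧
      ∀ z ∈ Metric.ball (0 : ℂ) R \ {0}, ‖U z‖ = Real.exp (φ z) * ‖z‖ ^ b := by
  have hRC : (R : ℂ) ≠ 0 := by exact_mod_cast hR.ne'
  have hmem : ∀ w : ℂ, w.re < 0 → (R : ℂ) * Complex.exp w ∈ Metric.ball (0 : ℂ) R \ {0} := by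
    intro w hw
    refine ⟨?_, by simp [hRC]⟩
    rw [mem_ball_zero_iff, norm_mul, Complex.norm_exp, Complex.norm_real, Real.norm_of_nonneg hR.le]
    have : Real.exp w.re < 1 := by simpa using hw
    nlinarith
  -- `w ↦ R * exp w` is the universal covering of the punctured disc by the left half-plane.
  obtain ⟨K, hK, hKφ⟩ := exists_re_eq_of_harmonicOnNhd_re_neg
    (Φ := fun w => φ (R * Complex.exp w)) fun w hw =>
      InnerProductSpace.HarmonicAt.comp_analyticAt (f := fun w => R * Complex.exp w)
        (hφ _ (hmem w hw)) (analyticAt_const.mul analyticAt_cexp)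
  have hopen : IsOpen {w : ℂ | w.re < 0} := isOpen_lt Complex.continuous_re continuous_const
  have hT : ∀ w : ℂ, (w + 2 * Real.pi * Complex.I).re = w.re := by simp
  -- `K` and its translate have the same real part, so `E` has modulus one and is constant by the
  -- maximum principle.
  set E : ℂ → ℂ := fun w => Complex.exp (K (w + 2 * Real.pi * Complex.I) - K w) with hE
  have hEd : DifferentiableOn ℂ E {w : ℂ | w.re < 0} := by
    refine DifferentiableOn.cexp (DifferentiableOn.sub ?_ hK)
    exact hK.comp (by fun_prop) fun w hw => by simpa using hw
  have hE1 : ∀ w : ℂ, w.re < 0 → ‖E w‖ = 1 := by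
    intro w hw
    have h1 := hKφ (w + 2 * Real.pi * Complex.I) (by rwa [hT])
    rw [Complex.exp_add, Complex.exp_two_pi_mul_I, mul_one] at h1
    rw [hE, Complex.norm_exp, Complex.sub_re, h1, hKφ w hw, sub_self, Real.exp_zero]
  have hconst : ∀ w : ℂ, w.re < 0 → E w = E (-1) := by
    intro w hw
    refine Complex.eqOn_of_isPreconnected_of_isMaxOn_norm (U := {w : ℂ | w.re < 0}) (c := -1)
      (convex_halfSpace_re_lt 0).isPreconnected hopen hEd (by simp) ?_ hw
    intro y hy
    simp only [Set.mem_ofPred_eq, Function.comp_apply] at hy ⊢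
    rw [hE1 y hy, hE1 (-1) (by simp)]
  set a : ℝ := Complex.arg (E (-1)) / (2 * Real.pi) with ha
  have hEa : E (-1) = Complex.exp (a * (2 * Real.pi * Complex.I)) := by
    have := Complex.norm_mul_exp_arg_mul_I (E (-1))
    rw [hE1 (-1) (by simp), Complex.ofReal_one, one_mul] at this
    rw [← this, ha]
    congr 1
    push_cast
    have : (Real.pi : ℂ) ≠ 0 := by exact_mod_cast Real.pi_ne_zero
    field_simp
  -- The term `a * w` cancels the period of `K` modulo `2πi`. The value `0` elsewhere makes `u`
  -- periodic on all of `ℂ`.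
  set u : ℂ → ℂ := fun w => if w.re < 0 then Complex.exp (K w - a * w) else 0 with hu
  have hper : Function.Periodic u (2 * Real.pi * Complex.I) := by
    intro w
    simp only [hu, hT]
    split_ifs with hw
    · have h1 := hconst w hw
      rw [hEa, hE] at h1
      simp only [Complex.exp_sub, mul_add, Complex.exp_add] at h1 ⊢
      rw [div_eq_iff (Complex.exp_ne_zero _)] at h1
      rw [h1]
      field_simp
    · rfl
  have hud : ∀ w : ℂ, w.re < 0 → DifferentiableAt ℂ u w := by
    intro w hw
    have : DifferentiableAt ℂ (fun w => Complex.exp (K w - a * w)) w := by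
      have := (hK w hw).differentiableAt (hopen.mem_nhds hw)
      fun_prop
    refine this.congr_of_eventuallyEq ?_
    filter_upwards [hopen.mem_nhds hw] with y hy
    simp only [hu]
    rw [if_pos hy]
  have hlogexp : ∀ w : ℂ, u (Complex.log (Complex.exp w)) = u w := by
    intro w
    obtain ⟨n, hn⟩ := Complex.log_exp_exists w
    rw [hn]
    exact hper.int_mul n w
  have hlogre : ∀ z ∈ Metric.ball (0 : ℂ) R \ {0}, z / R ≠ 0 ∧ Real.log ‖z / R‖ < 0 := by
    rintro z ⟨hz, hz0⟩
    have hz0' : z ≠ 0 := hz0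
    refine ⟨div_ne_zero hz0' hRC, Real.log_neg (norm_pos_iff.2 (div_ne_zero hz0' hRC)) ?_⟩
    rw [norm_div, Complex.norm_real, Real.norm_of_nonneg hR.le, div_lt_one hR]
    simpa using hz
  refine ⟨-a, fun z => Complex.exp (-a * Real.log R) * u (Complex.log (z / R)), ?_, ?_⟩
  · intro z hz
    obtain ⟨h0, h1⟩ := hlogre z hz
    refine DifferentiableAt.differentiableWithinAt (DifferentiableAt.const_mul ?_ _)
    -- Across the cut of `log`, the branch `log (-z / R) + πi` is used instead; periodicity makes
    -- `u` blind to the change.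
    rcases Complex.mem_slitPlane_or_neg_mem_slitPlane h0 with hs | hs
    · have hd : DifferentiableAt ℂ (fun z : ℂ => Complex.log (z / R)) z :=
        (differentiableAt_id.div_const (R : ℂ)).clog hs
      exact DifferentiableAt.fun_comp' z (hud _ (by rwa [Complex.log_re])) hd
    · have heq : (fun z : ℂ => u (Complex.log (z / R))) =ᶠ[𝓝 z]
          fun z => u (Complex.log (-(z / R)) + Real.pi * Complex.I) := by
        filter_upwards [isOpen_ne.mem_nhds (show z ≠ 0 from hz.2)] with y hy
        rw [← hlogexp (Complex.log (-(y / R)) + Real.pi * Complex.I), Complex.exp_add,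
          Complex.exp_pi_mul_I, Complex.exp_log (neg_ne_zero.2 (div_ne_zero hy hRC))]
        simp
      refine DifferentiableAt.congr_of_eventuallyEq ?_ heq
      have hd : DifferentiableAt ℂ (fun z : ℂ => Complex.log (-(z / R)) + Real.pi * Complex.I) z :=
        (DifferentiableAt.clog (f := fun z : ℂ => -(z / R)) (by fun_prop) hs).add_const _
      refine DifferentiableAt.fun_comp' z (hud _ ?_) hd
      rwa [Complex.add_re, Complex.log_re, norm_neg, Complex.re_ofReal_mul, Complex.I_re, mul_zero,
        add_zero]
  · intro z hz
    obtain ⟨h0, h1⟩ := hlogre z hz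
    have h2 : (Complex.log (z / R)).re < 0 := by rwa [Complex.log_re]
    have hz0 : 0 < ‖z‖ := norm_pos_iff.2 hz.2
    simp only [hu]
    rw [if_pos h2, norm_mul, Complex.norm_exp, Complex.norm_exp, Complex.sub_re, hKφ _ h2,
      Complex.exp_log h0, mul_div_cancel₀ _ hRC, Real.rpow_def_of_pos hz0, ← Real.exp_add,
      ← Real.exp_add]
    congr 1
    have h3 : ((a : ℂ) * Complex.log (z / R)).re = a * (Real.log ‖z‖ - Real.log R) := by
      rw [Complex.re_ofReal_mul, Complex.log_re, norm_div, Complex.norm_real,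
        Real.norm_of_nonneg hR.le, Real.log_div hz0.ne' hR.ne']
    have h4 : (-(a : ℂ) * (Real.log R : ℂ)).re = -a * Real.log R := by
      rw [← Complex.ofReal_neg, Complex.re_ofReal_mul, Complex.ofReal_re]
    rw [h3, h4]
    ring

/-! ### Area estimates in polar coordinates -/

open MeasureTheory in
theorem lintegral_eq_lintegral_polar {g : ℂ → ℝ≥0∞} (hg : Measurable g) :
    ∫⁻ z, g z = ∫⁻ ρ in Set.Ioi (0 : ℝ), ENNReal.ofReal ρ *
      ∫⁻ θ in Set.Ioo (-Real.pi) Real.pi, g (circleMap 0 ρ θ) := by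
  have hmeas : Measurable fun p : ℝ × ℝ => g (circleMap 0 p.1 p.2) := by
    refine hg.comp ?_
    unfold circleMap
    fun_prop
  rw [← Complex.lintegral_comp_polarCoord_symm, polarCoord_target, Measure.volume_eq_prod,
    ← Measure.prod_restrict]
  have h : ∀ p : ℝ × ℝ, ENNReal.ofReal p.1 • g (Complex.polarCoord.symm p) =
      ENNReal.ofReal p.1 * g (circleMap 0 p.1 p.2) := by
    intro p
    rw [Complex.polarCoord_symm_apply, circleMap_zero, Complex.exp_mul_I, smul_eq_mul]
    simp
  simp_rw [h]
  rw [lintegral_prod _ (by fun_prop)]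
  refine lintegral_congr fun ρ => ?_
  have hρ : Measurable fun θ => g (circleMap 0 ρ θ) :=
    hmeas.comp (measurable_const.prodMk measurable_id)
  change ∫⁻ θ, ENNReal.ofReal ρ * g (circleMap 0 ρ θ) ∂volume.restrict _ = _
  exact lintegral_const_mul (μ := volume.restrict (Set.Ioo (-Real.pi) Real.pi))
    (ENNReal.ofReal ρ) hρ

open MeasureTheory in
/-- The area submean value property of the norm of a holomorphic function. -/
theorem Complex.enorm_mul_area_le_lintegral_ball {f : ℂ → ℂ} {c : ℂ} {r : ℝ} (hr : 0 ≤ r)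
    (hf : DifferentiableOn ℂ f (Metric.ball c r)) :
    ENNReal.ofReal (Real.pi * r ^ 2) * ‖f c‖ₑ ≤ ∫⁻ z in Metric.ball c r, ‖f z‖ₑ := by
  classical
  -- Extension by zero to the plane allows translating to the origin and using polar coordinates
  -- there.
  set g : ℂ → ℝ≥0∞ := (Metric.ball c r).indicator fun z => ‖f z‖ₑ with hg
  have hgm : Measurable g :=
    hf.continuousOn.enorm.measurable_piecewise continuousOn_const measurableSet_ball
  have hcirc : ∀ ρ ∈ Set.Ioo 0 r, ENNReal.ofReal (2 * Real.pi) * ‖f c‖ₑ ≤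
      ∫⁻ θ in Set.Ioo (-Real.pi) Real.pi, g (c + circleMap 0 ρ θ) := by
    intro ρ hρ
    have hsub : Metric.closedBall c ρ ⊆ Metric.ball c r := Metric.closedBall_subset_ball hρ.2
    have hmv : Real.circleAverage f c ρ = f c := by
      refine DiffContOnCl.circleAverage (hf.diffContOnCl_ball ?_)
      rwa [abs_of_pos hρ.1]
    have hmem : ∀ θ, c + circleMap 0 ρ θ ∈ Metric.ball c r := by
      intro θ
      simpa [abs_of_pos hρ.1] using hρ.2
    have h1 : f c = (2 * Real.pi)⁻¹ • ∫ θ in Set.Ioo (-Real.pi) Real.pi,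
        f (c + circleMap 0 ρ θ) := by
      rw [← hmv, Real.circleAverage_eq_integral_add (-Real.pi),
        ← integral_Ioc_eq_integral_Ioo, intervalIntegral.integral_comp_add_right
          (fun θ => f (circleMap c ρ θ)), intervalIntegral.integral_of_le (by linarith [Real.pi_pos])]
      congr 2
      · congr 2 <;> ring
      · ext θ
        simp [circleMap]
    calc ENNReal.ofReal (2 * Real.pi) * ‖f c‖ₑ
        = ‖∫ θ in Set.Ioo (-Real.pi) Real.pi, f (c + circleMap 0 ρ θ)‖ₑ := by
          rw [h1, enorm_smul, ← mul_assoc, Real.enorm_eq_ofReal (by positivity),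
            ← ENNReal.ofReal_mul (by positivity), mul_inv_cancel₀ (by positivity),
            ENNReal.ofReal_one, one_mul]
      _ ≤ ∫⁻ θ in Set.Ioo (-Real.pi) Real.pi, ‖f (c + circleMap 0 ρ θ)‖ₑ :=
          enorm_integral_le_lintegral_enorm _
      _ = _ := by
          refine lintegral_congr fun θ => ?_
          rw [hg, Set.indicator_of_mem (hmem θ)]
  calc ENNReal.ofReal (Real.pi * r ^ 2) * ‖f c‖ₑ
      = ∫⁻ ρ in Set.Ioo 0 r, ENNReal.ofReal ρ * (ENNReal.ofReal (2 * Real.pi) * ‖f c‖ₑ) := by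
        have hI : ∫⁻ ρ in Set.Ioo 0 r, ENNReal.ofReal ρ = ENNReal.ofReal (r ^ 2 / 2) := by
          rw [← ofReal_integral_eq_lintegral_ofReal, ← integral_Ioc_eq_integral_Ioo,
            ← intervalIntegral.integral_of_le hr, integral_id]
          · simp
          · exact (continuous_id.integrableOn_Icc (a := 0) (b := r)).mono_set Set.Ioo_subset_Icc_self
          · filter_upwards [ae_restrict_mem measurableSet_Ioo] with ρ hρ using hρ.1.le
        rw [lintegral_mul_const _ (by fun_prop), hI, ← mul_assoc, ← ENNReal.ofReal_mul (by positivity)]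
        congr 2
        ring
    _ ≤ ∫⁻ ρ in Set.Ioo 0 r, ENNReal.ofReal ρ *
          ∫⁻ θ in Set.Ioo (-Real.pi) Real.pi, g (c + circleMap 0 ρ θ) :=
        setLIntegral_mono' measurableSet_Ioo fun ρ hρ => by gcongr; exact hcirc ρ hρ
    _ ≤ ∫⁻ ρ in Set.Ioi (0 : ℝ), ENNReal.ofReal ρ *
          ∫⁻ θ in Set.Ioo (-Real.pi) Real.pi, g (c + circleMap 0 ρ θ) :=
        lintegral_mono_set Set.Ioo_subset_Ioi_self
    _ = ∫⁻ z, g (c + z) :=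
        (lintegral_eq_lintegral_polar (g := fun z => g (c + z)) (by fun_prop)).symm
    _ = ∫⁻ z in Metric.ball c r, ‖f z‖ₑ := by
        rw [lintegral_add_left_eq_self, hg, lintegral_indicator measurableSet_ball]

open MeasureTheory in
/-- `|z|^(2β)` is not integrable near the origin if `β ≤ -1`. -/
theorem lintegral_norm_rpow_eq_top {β r : ℝ} (hβ : β ≤ -1) (hr : 0 < r) :
    ∫⁻ z in Metric.ball (0 : ℂ) r \ {0}, ENNReal.ofReal (‖z‖ ^ (2 * β)) = ⊤ := by
  -- For `ρ ≤ 1`, `ρ^(2β) ≥ ρ^(-2)`, so the integral over circles dominates that of `ρ⁻¹`, which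
  -- diverges at `0`.
  set s := min r 1 with hs
  have hs0 : 0 < s := lt_min hr one_pos
  have hmeas : MeasurableSet (Metric.ball (0 : ℂ) r \ {0}) :=
    measurableSet_ball.diff (measurableSet_singleton 0)
  rw [← lintegral_indicator hmeas, lintegral_eq_lintegral_polar
    (Measurable.indicator (by fun_prop) hmeas), eq_top_iff]
  have hdiv : ∫⁻ ρ in Set.Ioo 0 s, ENNReal.ofReal ρ⁻¹ = ⊤ := by
    by_contra h
    have hint : IntegrableOn (fun ρ : ℝ => ρ ^ (-1 : ℝ)) (Set.Ioo 0 s) := by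
      refine ⟨by fun_prop, ?_⟩
      rw [hasFiniteIntegral_iff_ofReal]
      · simp_rw [Real.rpow_neg_one]
        exact lt_top_iff_ne_top.2 h
      · filter_upwards [ae_restrict_mem measurableSet_Ioo] with ρ hρ
        exact Real.rpow_nonneg hρ.1.le _
    exact lt_irrefl _ ((intervalIntegral.integrableOn_Ioo_rpow_iff hs0).1 hint)
  calc (⊤ : ℝ≥0∞) = ∫⁻ ρ in Set.Ioo 0 s, ENNReal.ofReal ρ⁻¹ := hdiv.symm
    _ ≤ ∫⁻ ρ in Set.Ioo 0 s, ENNReal.ofReal ρ * ∫⁻ θ in Set.Ioo (-Real.pi) Real.pi,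
        (Metric.ball (0 : ℂ) r \ {0}).indicator (fun z => ENNReal.ofReal (‖z‖ ^ (2 * β)))
          (circleMap 0 ρ θ) := by
        refine setLIntegral_mono' measurableSet_Ioo fun ρ hρ => ?_
        have hρ0 : 0 < ρ := hρ.1
        have hmem : ∀ θ, circleMap 0 ρ θ ∈ Metric.ball (0 : ℂ) r \ {0} := by
          intro θ
          refine ⟨?_, circleMap_ne_center hρ0.ne'⟩
          simpa [abs_of_pos hρ0] using hρ.2.trans_le (min_le_left _ _)
        have h1 : ∀ θ, (Metric.ball (0 : ℂ) r \ {0}).indicator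
            (fun z => ENNReal.ofReal (‖z‖ ^ (2 * β))) (circleMap 0 ρ θ) =
            ENNReal.ofReal (ρ ^ (2 * β)) := by
          intro θ
          rw [Set.indicator_of_mem (hmem θ), norm_circleMap_zero, abs_of_pos hρ0]
        simp_rw [h1]
        rw [setLIntegral_const, Real.volume_Ioo, ← ENNReal.ofReal_mul (by positivity),
          ← ENNReal.ofReal_mul hρ0.le]
        refine ENNReal.ofReal_le_ofReal ?_
        have h2 : ρ ^ (-2 : ℝ) ≤ ρ ^ (2 * β) :=
          Real.rpow_le_rpow_of_exponent_ge hρ0 (hρ.2.le.trans (min_le_right _ _)) (by linarith)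
        have h3 : ρ⁻¹ = ρ * ρ ^ (-2 : ℝ) := by
          rw [Real.rpow_neg hρ0.le, Real.rpow_two]
          field_simp
        rw [h3]
        refine mul_le_mul_of_nonneg_left (h2.trans ?_) hρ0.le
        exact le_mul_of_one_le_right (by positivity) (by linarith [Real.pi_gt_three])
    _ ≤ _ := lintegral_mono_set Set.Ioo_subset_Ioi_self

-- The disc of radius `|z|` about `z` misses the origin, so there `exp (2 φ)` is the norm of a
-- holomorphic function. The submean value property bounds `π |z|^2 exp (2 φ z)` by the total area.
open MeasureTheory in
theorem exists_exp_mul_sq_norm_le {φ : ℂ → ℝ} {R : ℝ}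
    (hφ : InnerProductSpace.HarmonicOnNhd φ (Metric.ball 0 R \ {0}))
    (hint : ∫⁻ z in Metric.ball (0 : ℂ) R \ {0}, ENNReal.ofReal (Real.exp (2 * φ z)) < ⊤) :
    ∃ C : ℝ, ∀ z ∈ Metric.ball (0 : ℂ) (R / 2) \ {0}, Real.exp (2 * φ z) * ‖z‖ ^ 2 ≤ C := by
  set A := ∫⁻ z in Metric.ball (0 : ℂ) R \ {0}, ENNReal.ofReal (Real.exp (2 * φ z)) with hA
  refine ⟨A.toReal / Real.pi, fun z hz => ?_⟩
  have hsub : Metric.ball z ‖z‖ ⊆ Metric.ball (0 : ℂ) R \ {0} := by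
    intro y hy
    refine ⟨?_, ?_⟩
    · have h1 : ‖z‖ < R / 2 := by simpa using hz.1
      have h2 : ‖y - z‖ < ‖z‖ := by simpa [dist_eq_norm] using hy
      have h3 : ‖y‖ ≤ ‖y - z‖ + ‖z‖ := by simpa using norm_add_le (y - z) z
      rw [mem_ball_zero_iff]
      linarith
    · rintro rfl
      simp at hy
  obtain ⟨h, hh, hhφ⟩ := InnerProductSpace.HarmonicOnNhd.exists_analyticOnNhd_ball_re_eq
    (hφ.mono hsub)
  have hnorm : ∀ y ∈ Metric.ball z ‖z‖,
      ‖Complex.exp (2 * h y)‖ₑ = ENNReal.ofReal (Real.exp (2 * φ y)) := by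
    intro y hy
    have h1 : (h y).re = φ y := hhφ hy
    have h2 : (2 * h y).re = 2 * φ y := by simp [h1]
    rw [← ofReal_norm, Complex.norm_exp, h2]
  have hz0 : 0 < ‖z‖ := norm_pos_iff.2 hz.2
  have hmv := Complex.enorm_mul_area_le_lintegral_ball (f := fun y => Complex.exp (2 * h y))
    hz0.le (hh.differentiableOn.const_mul 2).cexp
  rw [hnorm z (Metric.mem_ball_self hz0), setLIntegral_congr_fun measurableSet_ball hnorm,
    ← ENNReal.ofReal_mul (by positivity)] at hmv
  have h3 := hmv.trans (lintegral_mono_set hsub)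
  rw [← hA, ENNReal.ofReal_le_iff_le_toReal hint.ne] at h3
  rw [le_div_iff₀ Real.pi_pos]
  linarith

/-! ### The exponent at the puncture -/

open MeasureTheory in
/-- A flat metric `exp (2 φ) |dz|²` of finite area on a punctured disc has
`exp φ = |z|^β |v|` near the puncture, with `v` holomorphic, `v 0 ≠ 0`, and `β > -1`. -/
theorem exists_exp_eq_norm_rpow_mul_norm {φ : ℂ → ℝ} {R : ℝ} (hR : 0 < R)
    (hφ : InnerProductSpace.HarmonicOnNhd φ (Metric.ball 0 R \ {0}))
    (hint : ∫⁻ z in Metric.ball (0 : ℂ) R \ {0}, ENNReal.ofReal (Real.exp (2 * φ z)) < ⊤) :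
    ∃ (β : ℝ) (v : ℂ → ℂ), -1 < β ∧ AnalyticAt ℂ v 0 ∧ v 0 ≠ 0 ∧
      ∀ᶠ z in 𝓝[≠] (0 : ℂ), Real.exp (φ z) = ‖z‖ ^ β * ‖v z‖ := by
  obtain ⟨b, U, hU, hUφ⟩ := exists_differentiableOn_norm_eq hR hφ
  obtain ⟨C, hC⟩ := exists_exp_mul_sq_norm_le hφ hint
  -- With `N + b ≥ 1`, `|z^N U| ≤ exp φ * |z| ≤ √C` near `0`, so the singularity of `z^N U` is
  -- removable.
  obtain ⟨N, hN⟩ := exists_nat_ge (1 - b)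
  set s := min (R / 2) 1 with hs
  have hs0 : 0 < s := lt_min (by positivity) one_pos
  have hsR : s < R := (min_le_left _ _).trans_lt (by linarith)
  have hsub : Metric.ball (0 : ℂ) s \ {0} ⊆ Metric.ball 0 R \ {0} :=
    Set.sdiff_subset_sdiff_left (Metric.ball_subset_ball hsR.le)
  set f : ℂ → ℂ := fun z => z ^ N * U z with hf
  have hfn : ∀ z ∈ Metric.ball (0 : ℂ) s \ {0}, ‖f z‖ = Real.exp (φ z) * ‖z‖ ^ (N + b) := by
    intro z hz
    have hz0 : 0 < ‖z‖ := norm_pos_iff.2 hz.2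
    rw [hf, norm_mul, norm_pow, hUφ z (hsub hz), Real.rpow_add hz0, Real.rpow_natCast]
    ring
  have hbdd : BddAbove (norm ∘ f '' (Metric.ball (0 : ℂ) s \ {0})) := by
    refine ⟨Real.sqrt C, ?_⟩
    rintro _ ⟨z, hz, rfl⟩
    have hz0 : 0 < ‖z‖ := norm_pos_iff.2 hz.2
    have hzs : ‖z‖ < s := by simpa using hz.1
    have h1 := hC z ⟨Metric.ball_subset_ball (min_le_left _ _) hz.1, hz.2⟩
    rw [Function.comp_apply, hfn z hz]
    refine Real.le_sqrt_of_sq_le (le_trans ?_ h1)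
    rw [mul_pow, ← Real.exp_nat_mul, Nat.cast_two]
    refine mul_le_mul_of_nonneg_left ?_ (Real.exp_nonneg _)
    refine pow_le_pow_left₀ (Real.rpow_nonneg hz0.le _) ?_ 2
    calc ‖z‖ ^ (N + b) ≤ ‖z‖ ^ (1 : ℝ) :=
          Real.rpow_le_rpow_of_exponent_ge hz0 (hzs.le.trans (min_le_right _ _)) (by linarith)
      _ = ‖z‖ := Real.rpow_one _
  have hfd : DifferentiableOn ℂ f (Metric.ball (0 : ℂ) s \ {0}) :=
    (differentiableOn_id.pow N).mul (hU.mono hsub)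
  have hgd := Complex.differentiableOn_update_limUnder_of_bddAbove (Metric.ball_mem_nhds 0 hs0)
    hfd hbdd
  set g := Function.update f 0 (Filter.limUnder (𝓝[≠] 0) f) with hg
  have hga : AnalyticAt ℂ g 0 := hgd.analyticAt (Metric.ball_mem_nhds 0 hs0)
  have hpunct : ∀ᶠ z in 𝓝[≠] (0 : ℂ), z ∈ Metric.ball (0 : ℂ) s \ {0} :=
    sdiff_mem_nhdsWithin_compl (Metric.ball_mem_nhds 0 hs0) _
  have hgf : ∀ z ∈ Metric.ball (0 : ℂ) s \ {0},
      ‖g z‖ = Real.exp (φ z) * ‖z‖ ^ (N + b) := by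
    intro z hz
    rw [← hfn z hz, hg, Function.update_of_ne hz.2]
  have hnz : ¬ ∀ᶠ z in 𝓝 (0 : ℂ), g z = 0 := by
    intro h
    obtain ⟨z, hz, hz'⟩ := ((h.filter_mono nhdsWithin_le_nhds).and hpunct).exists
    have h1 := hgf z hz'
    have hz0 : 0 < ‖z‖ := norm_pos_iff.2 hz'.2
    rw [hz, norm_zero] at h1
    have : 0 < Real.exp (φ z) * ‖z‖ ^ (N + b) := by positivity
    linarith
  obtain ⟨n, v, hv, hv0, hgv⟩ := hga.exists_eventuallyEq_pow_smul_nonzero_iff.2 hnz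
  have key : ∀ᶠ z in 𝓝[≠] (0 : ℂ), Real.exp (φ z) = ‖z‖ ^ (n - N - b) * ‖v z‖ := by
    filter_upwards [hpunct, hgv.filter_mono nhdsWithin_le_nhds] with z hz hzv
    have hz0 : 0 < ‖z‖ := norm_pos_iff.2 hz.2
    have h1 := hgf z hz
    rw [hzv, sub_zero, norm_smul, norm_pow] at h1
    rw [show (n : ℝ) - N - b = n - (N + b) by ring, Real.rpow_sub hz0, Real.rpow_natCast,
      div_mul_eq_mul_div, h1, mul_div_cancel_right₀ _ (Real.rpow_pos_of_pos hz0 _).ne']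
  refine ⟨n - N - b, v, ?_, hv, hv0, key⟩
  -- If `β ≤ -1`, then `exp (2 φ) ≥ c^2 |z|^(2β)` near `0`, contradicting finite area.
  by_contra! hβ
  set β : ℝ := n - N - b with hβdef
  set c := ‖v 0‖ / 2 with hc
  have hc0 : 0 < c := by positivity
  have hvc : ∀ᶠ z in 𝓝 (0 : ℂ), c < ‖v z‖ :=
    hv.continuousAt.norm.eventually_const_lt (half_lt_self (norm_pos_iff.2 hv0))
  have hballR : ∀ᶠ z in 𝓝[≠] (0 : ℂ), z ∈ Metric.ball (0 : ℂ) R :=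
    nhdsWithin_le_nhds (Metric.ball_mem_nhds (0 : ℂ) hR)
  have hev := (key.and (hvc.filter_mono nhdsWithin_le_nhds)).and hballR
  rw [eventually_nhdsWithin_iff, Metric.eventually_nhds_iff_ball] at hev
  obtain ⟨t, ht, hball⟩ := hev
  have hmeas : MeasurableSet (Metric.ball (0 : ℂ) t \ {0}) :=
    measurableSet_ball.diff (measurableSet_singleton 0)
  have htop : ∫⁻ z in Metric.ball (0 : ℂ) t \ {0},
      ENNReal.ofReal (c ^ 2) * ENNReal.ofReal (‖z‖ ^ (2 * β)) = ⊤ := by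
    rw [lintegral_const_mul _ (by fun_prop), lintegral_norm_rpow_eq_top hβ ht,
      ENNReal.mul_top (by simpa using hc0.ne')]
  refine hint.ne (eq_top_iff.2 (htop.symm.le.trans ?_))
  refine (setLIntegral_mono' hmeas fun z hz => ?_).trans
    (lintegral_mono_set (t := Metric.ball (0 : ℂ) R \ {0})
      fun z hz => ⟨(hball z hz.1 hz.2).2, hz.2⟩)
  obtain ⟨⟨h1, h2⟩, -⟩ := hball z hz.1 hz.2
  rw [← ENNReal.ofReal_mul (by positivity)]
  refine ENNReal.ofReal_le_ofReal ?_
  have h3 : Real.exp (2 * φ z) = ‖v z‖ ^ 2 * ‖z‖ ^ (2 * β) := by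
    rw [two_mul, Real.exp_add, h1, two_mul, Real.rpow_add (norm_pos_iff.2 hz.2)]
    ring
  rw [h3]
  gcongr

/-! ### The normalising coordinate -/

open MeasureTheory in
/-- Holomorphic solutions of the Euler equation `z Q' + (β + 1) Q = v`. -/
theorem exists_hasDerivAt_euler {β : ℝ} (hβ : -1 < β) {v : ℂ → ℂ} (hv : AnalyticAt ℂ v 0) :
    ∃ Q : ℂ → ℂ, ∀ᶠ z in 𝓝 (0 : ℂ), ∃ Q', HasDerivAt Q Q' z ∧ z * Q' + (β + 1) * Q z = v z := by
  obtain ⟨M, hM⟩ : ∃ M : ℝ, ∀ᶠ z in 𝓝 (0 : ℂ), ‖deriv v z‖ ≤ M := by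
    refine ⟨‖deriv v 0‖ + 1, ?_⟩
    filter_upwards [hv.deriv.continuousAt.norm.eventually_lt_const (lt_add_one _)] with z hz
      using hz.le
  obtain ⟨r, hr, hball⟩ := Metric.eventually_nhds_iff_ball.1 (hv.eventually_analyticAt.and hM)
  have hmem : ∀ z ∈ Metric.ball (0 : ℂ) r, ∀ t ∈ Set.Icc (0 : ℝ) 1,
      (t : ℂ) * z ∈ Metric.ball (0 : ℂ) r := by
    intro z hz t ht
    rw [mem_ball_zero_iff] at hz ⊢
    rw [norm_mul, Complex.norm_real, Real.norm_of_nonneg ht.1]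
    nlinarith [ht.2, norm_nonneg z]
  have hI : Set.uIoc (0 : ℝ) 1 ⊆ Set.Icc 0 1 := by
    rw [Set.uIoc_of_le zero_le_one]
    exact Set.Ioc_subset_Icc_self
  have hI' : Set.uIcc (0 : ℝ) 1 = Set.Icc 0 1 := Set.uIcc_of_le zero_le_one
  have hpow : IntervalIntegrable (fun t : ℝ => ((t ^ β : ℝ) : ℂ)) volume 0 1 :=
    ⟨(intervalIntegral.intervalIntegrable_rpow' hβ).1.ofReal,
      (intervalIntegral.intervalIntegrable_rpow' hβ).2.ofReal⟩
  have hcont : ∀ {u : ℂ → ℂ}, (∀ z ∈ Metric.ball (0 : ℂ) r, ContinuousAt u z) →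
      ∀ z ∈ Metric.ball (0 : ℂ) r, ContinuousOn (fun t : ℝ => u (t * z)) (Set.uIcc 0 1) := by
    intro u hu z hz t ht
    rw [hI'] at ht
    refine ContinuousAt.continuousWithinAt ?_
    exact ContinuousAt.comp' (hu _ (hmem z hz t ht)) (by fun_prop)
  have hvc := hcont (u := v) fun z hz => (hball z hz).1.continuousAt
  have hdc := hcont (u := deriv v) fun z hz => (hball z hz).1.deriv.continuousAt
  have hint : ∀ z ∈ Metric.ball (0 : ℂ) r,
      IntervalIntegrable (fun t : ℝ => ((t ^ β : ℝ) : ℂ) * v (t * z)) volume 0 1 :=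
    fun z hz => hpow.mul_continuousOn (hvc z hz)
  have hint' : ∀ z ∈ Metric.ball (0 : ℂ) r, IntervalIntegrable
      (fun t : ℝ => ((t ^ β : ℝ) : ℂ) * (t * deriv v (t * z))) volume 0 1 :=
    fun z hz => hpow.mul_continuousOn (Complex.continuous_ofReal.continuousOn.mul (hdc z hz))
  -- This is `z^(-β-1) ∫ ζ^β v(ζ) dζ` from `0` to `z`, rescaled by `ζ = t z` to be free of branches;
  -- it converges because `β > -1`.
  refine ⟨fun z => ∫ t in (0 : ℝ)..1, ((t ^ β : ℝ) : ℂ) * v (t * z), ?_⟩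
  filter_upwards [Metric.ball_mem_nhds (0 : ℂ) hr] with z hz
  refine ⟨∫ t in (0 : ℝ)..1, ((t ^ β : ℝ) : ℂ) * (t * deriv v (t * z)), ?_, ?_⟩
  · refine (intervalIntegral.hasDerivAt_integral_of_dominated_loc_of_deriv_le
      (F := fun z (t : ℝ) => ((t ^ β : ℝ) : ℂ) * v (t * z))
      (F' := fun z (t : ℝ) => ((t ^ β : ℝ) : ℂ) * (t * deriv v (t * z)))
      (bound := fun t : ℝ => t ^ β * M) (Metric.isOpen_ball.mem_nhds hz) ?_ (hint z hz) ?_ ?_ ?_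
      ?_).2
    · filter_upwards [Metric.isOpen_ball.mem_nhds hz] with y hy
      exact (hint y hy).def'.aestronglyMeasurable
    · exact (hint' z hz).def'.aestronglyMeasurable
    · refine Filter.Eventually.of_forall fun t ht y hy => ?_
      have ht' := hI ht
      rw [norm_mul, norm_mul, Complex.norm_real, Complex.norm_real, Real.norm_of_nonneg ht'.1,
        Real.norm_of_nonneg (Real.rpow_nonneg ht'.1 _)]
      have h1 := (hball _ (hmem y hy t ht')).2
      have h2 := norm_nonneg (deriv v (t * y))
      refine mul_le_mul_of_nonneg_left ?_ (Real.rpow_nonneg ht'.1 _)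
      nlinarith [ht'.2]
    · exact (intervalIntegral.intervalIntegrable_rpow' hβ).mul_const _
    · refine Filter.Eventually.of_forall fun t ht y hy => ?_
      refine HasDerivAt.const_mul _ ?_
      have h1 := (hball _ (hmem y hy t (hI ht))).1.differentiableAt.hasDerivAt
      have h2 : HasDerivAt (fun y : ℂ => (t : ℂ) * y) (t : ℂ) y := by
        simpa using (hasDerivAt_id y).const_mul (t : ℂ)
      rw [mul_comm]
      exact HasDerivAt.comp y h1 h2
  · rw [← intervalIntegral.integral_const_mul, ← intervalIntegral.integral_const_mul,
      ← intervalIntegral.integral_add ((hint' z hz).const_mul _) ((hint z hz).const_mul _)]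
    have hβ' : β + 1 ≠ 0 := by linarith
    -- The integrand is the `t`-derivative of `t^(β+1) v(t z)`, which vanishes at `t = 0`.
    rw [intervalIntegral.integral_eq_sub_of_hasDerivAt_of_le
      (f := fun t : ℝ => ((t ^ (β + 1) : ℝ) : ℂ) * v (t * z)) zero_le_one]
    · simp [Real.zero_rpow hβ']
    · refine ContinuousOn.mul ?_ (hI' ▸ hvc z hz)
      exact (Complex.continuous_ofReal.comp
        (Real.continuous_rpow_const (by linarith))).continuousOn
    · intro t ht
      have h1 := (hball _ (hmem z hz t (Set.Ioo_subset_Icc_self ht))).1.differentiableAt.hasDerivAt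
      have h2 : HasDerivAt (fun t : ℝ => (t : ℂ) * z) z t := by
        simpa using (HasDerivAt.ofReal_comp (hasDerivAt_id t)).mul_const z
      have h3 := (Real.hasDerivAt_rpow_const (p := β + 1) (Or.inl ht.1.ne')).ofReal_comp
      have h4 := h3.mul (HasDerivAt.comp t h1 h2)
      refine h4.congr_deriv ?_
      rw [add_sub_cancel_right, Real.rpow_add_one ht.1.ne']
      simp only [Function.comp_apply]
      push_cast
      ring
    · exact ((hint' z hz).const_mul _).add ((hint z hz).const_mul _)

/-- Near the origin, `|z|^β |v| |dz|` is the pullback of `(β + 1) |w|^β |dw|` under a holomorphic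
change of coordinate `w` fixing the origin. -/
theorem exists_analyticAt_norm_rpow_mul_norm_deriv {β : ℝ} (hβ : -1 < β) {v : ℂ → ℂ}
    (hv : AnalyticAt ℂ v 0) (hv0 : v 0 ≠ 0) :
    ∃ w : ℂ → ℂ, AnalyticAt ℂ w 0 ∧ w 0 = 0 ∧ deriv w 0 ≠ 0 ∧
      ∀ᶠ z in 𝓝 (0 : ℂ), (β + 1) * ‖w z‖ ^ β * ‖deriv w z‖ = ‖z‖ ^ β * ‖v z‖ := by
  obtain ⟨Q, hQ⟩ := exists_hasDerivAt_euler hβ hv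
  have hβ0 : 0 < β + 1 := by linarith
  have hβC : (β : ℂ) + 1 ≠ 0 := by exact_mod_cast hβ0.ne'
  have hQa : AnalyticAt ℂ Q 0 := by
    rw [Complex.analyticAt_iff_eventually_differentiableAt]
    filter_upwards [hQ] with z ⟨Q', h, _⟩ using h.differentiableAt
  have hQ0 : Q 0 ≠ 0 := by
    obtain ⟨Q', -, h⟩ := hQ.self_of_nhds
    intro h0
    rw [h0, zero_mul, mul_zero, add_zero] at h
    exact hv0 h.symm
  -- A branch of `log Q` near `0`: the quotient is close to `1`, away from the cut. Then `k` is
  -- `Q^(1/(β+1))`.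
  set l : ℂ → ℂ := fun z => Complex.log (Q z / Q 0) + Complex.log (Q 0) with hl
  set k : ℂ → ℂ := fun z => Complex.exp (l z / (β + 1)) with hk
  have hslit : ∀ᶠ z in 𝓝 (0 : ℂ), Q z / Q 0 ∈ Complex.slitPlane := by
    refine (hQa.continuousAt.div_const (Q 0)).preimage_mem_nhds
      (Complex.isOpen_slitPlane.mem_nhds ?_)
    rw [div_self hQ0]
    exact Complex.one_mem_slitPlane
  have hw' : ∀ᶠ z in 𝓝 (0 : ℂ), ∃ Q', z * Q' + (β + 1) * Q z = v z ∧ Q z ≠ 0 ∧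
      HasDerivAt (fun z => z * k z) (k z * v z / ((β + 1) * Q z)) z ∧
      ‖k z‖ ^ (β + 1) = ‖Q z‖ := by
    filter_upwards [hQ, hslit, hQa.continuousAt.eventually_ne hQ0] with z ⟨Q', hd, he⟩ hs hne
    refine ⟨Q', he, hne, ?_, ?_⟩
    · have h1 : HasDerivAt l (Q' / Q z) z := by
        refine (((hd.div_const (Q 0)).clog hs).add_const _).congr_deriv ?_
        field_simp
      have h2 := (hasDerivAt_id z).mul (h1.div_const ((β : ℂ) + 1)).cexp
      refine h2.congr_deriv ?_
      simp only [id_eq, ← he, hk]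
      field_simp
      ring
    · have h1 : Complex.exp (l z) = Q z := by
        rw [hl, Complex.exp_add, Complex.exp_log (div_ne_zero hne hQ0), Complex.exp_log hQ0,
          div_mul_cancel₀ _ hQ0]
      have h2 : (l z / ((β : ℂ) + 1)).re = (l z).re / (β + 1) := by
        rw [← Complex.ofReal_one, ← Complex.ofReal_add, Complex.div_ofReal_re]
      rw [hk, Complex.norm_exp, ← Real.exp_mul, h2, div_mul_cancel₀ _ hβ0.ne', ← Complex.norm_exp,
        h1]
  refine ⟨fun z => z * k z, ?_, by simp, ?_, ?_⟩
  · rw [Complex.analyticAt_iff_eventually_differentiableAt]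
    filter_upwards [hw'] with z ⟨_, _, _, h, _⟩ using h.differentiableAt
  · obtain ⟨_, _, h0, h, -⟩ := hw'.self_of_nhds
    rw [h.deriv]
    exact div_ne_zero (mul_ne_zero (Complex.exp_ne_zero _) hv0) (mul_ne_zero hβC h0)
  · filter_upwards [hw'] with z ⟨_, _, h0, h, hn⟩
    have hk0 : 0 < ‖k z‖ := norm_pos_iff.2 (Complex.exp_ne_zero _)
    have hβn : ‖(β : ℂ) + 1‖ = β + 1 := by
      rw [← Complex.ofReal_one, ← Complex.ofReal_add, Complex.norm_real,
        Real.norm_of_nonneg hβ0.le]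
    rw [h.deriv, norm_mul, norm_div, norm_mul, norm_mul, hβn, ← hn, Real.rpow_add_one hk0.ne',
      Real.mul_rpow (norm_nonneg _) hk0.le]
    have := (Real.rpow_pos_of_pos hk0 β).ne'
    field_simp

/-- The inverse function theorem for holomorphic functions of one variable, in terms of
biholomorphic maps between open sets. -/
theorem AnalyticAt.exists_openPartialHomeomorph {w : ℂ → ℂ} {a : ℂ} (hw : AnalyticAt ℂ w a)
    (hw' : deriv w a ≠ 0) :
    ∃ f : OpenPartialHomeomorph ℂ ℂ, (∀ z, f z = w z) ∧ a ∈ f.source ∧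
      ContDiffOn ℂ ω f f.source ∧ ContDiffOn ℂ ω f.symm f.target := by
  have hd := (hw.differentiableAt.hasDerivAt).hasFDerivAt_equiv hw'
  set f := hw.contDiffAt.toOpenPartialHomeomorph w (n := ω) hd (by simp)
  have hfa : a ∈ f.source := hw.contDiffAt.mem_toOpenPartialHomeomorph_source hd (by simp)
  have hSn : ∀ᶠ z in 𝓝 a, AnalyticAt ℂ w z ∧ deriv w z ≠ 0 :=
    hw.eventually_analyticAt.and (hw.deriv.continuousAt.eventually_ne hw')
  -- Shrinking to `s` makes the inverse analytic on the whole target, not just at the image of `a`.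
  obtain ⟨s, hs, hso, has⟩ := mem_nhds_iff.1 hSn
  refine ⟨f.restrOpen s hso, fun z => rfl, ⟨hfa, has⟩, ?_, ?_⟩
  · intro z hz
    exact (hs hz.2).1.contDiffAt.contDiffWithinAt
  · intro y hy
    have hy' : y ∈ f.target ∧ f.symm y ∈ s := by
      have h1 := (f.restrOpen s hso).map_target hy
      refine ⟨?_, h1.2⟩
      have h2 := f.map_source h1.1
      have h3 := (f.restrOpen s hso).right_inv hy
      change f (f.symm y) = y at h3
      change f (f.symm y) ∈ f.target at h2
      rwa [h3] at h2
    have hz := hs hy'.2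
    exact (f.contDiffAt_symm_deriv hz.2 hy'.1 hz.1.differentiableAt.hasDerivAt
      hz.1.contDiffAt).contDiffWithinAt

/-! ### Transfer to the Riemann surface -/

section RiemannSurface

variable {X : Type*} [TopologicalSpace X] [ChartedSpace ℂ X]

/-- Composing a coordinate with a holomorphic function with nonvanishing derivative gives a
coordinate, on arbitrarily small neighbourhoods. -/
theorem IsHolCoord.exists_comp [IsManifold 𝓘(ℂ) ω X]
    {e : OpenPartialHomeomorph X ℂ} (he : IsHolCoord e) {p : X}
    (hp : p ∈ e.source) {w : ℂ → ℂ} (hw : AnalyticAt ℂ w (e p)) (hw' : deriv w (e p) ≠ 0)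
    {s : Set X} (hs : s ∈ 𝓝 p) :
    ∃ e' : OpenPartialHomeomorph X ℂ, IsHolCoord e' ∧ p ∈ e'.source ∧
      e'.source ⊆ s ∩ e.source ∧ ∀ x, e' x = w (e x) := by
  obtain ⟨f, hfw, hpf, hf, hf'⟩ := hw.exists_openPartialHomeomorph hw'
  obtain ⟨u, hus, huo, hpu⟩ := mem_nhds_iff.1 hs
  have he' := (IsManifold.mem_maximalAtlas_iff_contMDiffOn e).1 he
  have hc : IsHolCoord (e.trans f) := by
    refine OpenPartialHomeomorph.mem_maximalAtlas_of_contMDiffOn _ ?_ ?_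
    · exact hf.contMDiffOn.comp (he'.1.mono fun x hx => hx.1) fun x hx => hx.2
    · exact he'.2.comp (hf'.contMDiffOn.mono fun x hx => hx.1) fun x hx => hx.2
  refine ⟨(e.trans f).restr u, restr_mem_maximalAtlas _ hc huo, ?_, ?_, fun x => hfw _⟩
  · rw [OpenPartialHomeomorph.restr_source, huo.interior_eq]
    exact ⟨⟨hp, hpf⟩, hpu⟩
  · rw [OpenPartialHomeomorph.restr_source, huo.interior_eq]
    exact fun x hx => ⟨hus hx.2, hx.1.1⟩

namespace ConformalMetric

variable {Ω : TopologicalSpace.Opens X} (g : ConformalMetric X Ω)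

theorem logDensity_eq_of_comp {e e' : OpenPartialHomeomorph X ℂ} (he : IsHolCoord e)
    (he' : IsHolCoord e') {w : ℂ → ℂ} (hsub : e'.source ⊆ e.source)
    (hw : ∀ x, e' x = w (e x)) {x : X} (hx : x ∈ e'.source) (hxΩ : x ∈ Ω) :
    g.logDensity e (e x) = g.logDensity e' (e' x) + Real.log ‖deriv w (e x)‖ := by
  rw [g.logDensity_change e e' he he' x hxΩ (hsub hx) hx]
  congr 3
  refine Filter.EventuallyEq.deriv_eq ?_
  filter_upwards [e.open_target.mem_nhds (e.map_source (hsub hx))] with z hz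
  rw [hw, e.right_inv hz]

theorem IsFlat.harmonicAt {g : ConformalMetric X Ω} (hg : g.IsFlat)
    {e : OpenPartialHomeomorph X ℂ} (he : IsHolCoord e) {x : X} (hx : x ∈ e.source)
    (hxΩ : x ∈ Ω) : InnerProductSpace.HarmonicAt (g.logDensity e) (e x) := by
  have hopen : IsOpen (e.target ∩ e.symm ⁻¹' (Ω : Set X)) :=
    e.isOpen_inter_preimage_symm Ω.isOpen
  have hmem : e.target ∩ e.symm ⁻¹' (Ω : Set X) ∈ 𝓝 (e x) := by
    refine hopen.mem_nhds ⟨e.map_source hx, ?_⟩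
    rwa [Set.mem_preimage, e.left_inv hx]
  refine ⟨(g.contDiffOn_logDensity e he).contDiffAt hmem, ?_⟩
  filter_upwards [hmem] with z hz
  have h1 := hg e he (e.symm z) hz.2 (e.map_target hz.1)
  rw [e.right_inv hz.1, gaussCurvature] at h1
  simpa [Real.exp_ne_zero] using h1

theorem areaInCoord_le_area {e : OpenPartialHomeomorph X ℂ} (he : IsHolCoord e) {B : Set X}
    (hB : B ⊆ (Ω : Set X) ∩ e.source) (hm : MeasurableSet (e '' B)) :
    g.areaInCoord e B ≤ g.area := by
  refine le_trans (le_of_eq ?_) (le_iSup₂_of_le 1 (fun _ => e) (le_iSup₂_of_le (fun _ => B)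
    (fun _ => ⟨he, hB, hm⟩) (le_iSup_of_le (fun i j hij => (hij (Subsingleton.elim i j)).elim)
      le_rfl)))
  simp

theorem IsCoordCentredAt.symm_mem {g : ConformalMetric X Ω} {e : OpenPartialHomeomorph X ℂ}
    {p : X} (he : g.IsCoordCentredAt e p) {z : ℂ} (hz : z ∈ e.target) (hz0 : z ≠ 0) :
    e.symm z ∈ Ω := by
  refine he.2.2.2 ⟨e.map_target hz, fun h => hz0 ?_⟩
  rw [← e.right_inv hz, show e.symm z = p from h, he.2.2.1]

/-- A holomorphic change of variable `w` fixing the origin turns a centred coordinate into a centred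
coordinate, on so small a neighbourhood that a given local property of the old one holds. -/
theorem IsCoordCentredAt.exists_comp [IsManifold 𝓘(ℂ) ω X]
    {g : ConformalMetric X Ω} {e : OpenPartialHomeomorph X ℂ}
    {p : X} (he : g.IsCoordCentredAt e p) {w : ℂ → ℂ} (hw : AnalyticAt ℂ w 0) (hw0 : w 0 = 0)
    (hw' : deriv w 0 ≠ 0) {P : ℂ → Prop} (hP : ∀ᶠ z in 𝓝 (0 : ℂ), P z) :
    ∃ e' : OpenPartialHomeomorph X ℂ, g.IsCoordCentredAt e' p ∧
      ∀ y ∈ e'.target, ∃ z ∈ e.target, y = w z ∧ P z ∧ (y ≠ 0 → z ≠ 0 ∧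
        g.logDensity e z = g.logDensity e' y + Real.log ‖deriv w z‖) := by
  obtain ⟨he1, hp, hp0, hΩ⟩ := he
  obtain ⟨e', he', hp', hsub, hew⟩ := he1.exists_comp hp (w := w) (by rwa [hp0]) (by rwa [hp0])
    ((e.continuousAt hp).preimage_mem_nhds (by rwa [hp0]))
  have hc : g.IsCoordCentredAt e' p :=
    ⟨he', hp', by rw [hew, hp0, hw0], fun x hx => hΩ ⟨(hsub hx.1).2, hx.2⟩⟩
  refine ⟨e', hc, fun y hy => ?_⟩
  have hx := e'.map_target hy
  have hyw : y = w (e (e'.symm y)) := by rw [← hew, e'.right_inv hy]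
  refine ⟨e (e'.symm y), e.map_source (hsub hx).2, hyw, (hsub hx).1, fun hy0 => ⟨?_, ?_⟩⟩
  · intro h
    rw [h, hw0] at hyw
    exact hy0 hyw
  · rw [g.logDensity_eq_of_comp he1 he' (fun x hx => (hsub hx).2) hew hx (hc.symm_mem hy hy0),
      e'.right_inv hy]

theorem IsIsolatedSingularity.exists_isCoordCentredAt [IsManifold 𝓘(ℂ) ω X]
    {g : ConformalMetric X Ω} {p : X}
    (hp : g.IsIsolatedSingularity p) : ∃ e, g.IsCoordCentredAt e p := by
  have he : IsHolCoord (chartAt ℂ p) := IsManifold.chart_mem_maximalAtlas p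
  obtain ⟨e', he', hpe', hsub, hew⟩ := he.exists_comp (mem_chart_source ℂ p)
    (w := fun z => z - chartAt ℂ p p) (analyticAt_id.sub analyticAt_const) (by simp)
    (mem_nhdsWithin_iff_exists_mem_nhds_inter.1 hp.2).choose_spec.1
  refine ⟨e', he', hpe', by rw [hew, sub_self], fun x hx => ?_⟩
  exact (mem_nhdsWithin_iff_exists_mem_nhds_inter.1 hp.2).choose_spec.2 ⟨(hsub hx.1).1, hx.2⟩

theorem IsCoordCentredAt.exists_exp_logDensity_eq {g : ConformalMetric X Ω}
    {e : OpenPartialHomeomorph X ℂ} {p : X} (he : g.IsCoordCentredAt e p) (hflat : g.IsFlat)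
    (harea : g.area < (⊤ : ℝ≥0∞)) :
    ∃ (β : ℝ) (v : ℂ → ℂ), -1 < β ∧ AnalyticAt ℂ v 0 ∧ v 0 ≠ 0 ∧
      ∀ᶠ z in 𝓝[≠] (0 : ℂ), Real.exp (g.logDensity e z) = ‖z‖ ^ β * ‖v z‖ := by
  have h0 : (0 : ℂ) ∈ e.target := by
    rw [← he.2.2.1]
    exact e.map_source he.2.1
  obtain ⟨R, hR, hball⟩ := Metric.isOpen_iff.1 e.open_target 0 h0
  have himage : e '' (e.symm '' (Metric.ball (0 : ℂ) R \ {0})) = Metric.ball (0 : ℂ) R \ {0} := by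
    rw [Set.image_image]
    refine (Set.image_congr fun z hz => e.right_inv (hball hz.1)).trans ?_
    simp
  refine exists_exp_eq_norm_rpow_mul_norm hR (fun z hz => ?_) (lt_of_le_of_lt ?_ harea)
  · have := hflat.harmonicAt he.1 (e.map_target (hball hz.1)) (he.symm_mem (hball hz.1) hz.2)
    rwa [e.right_inv (hball hz.1)] at this
  · have := g.areaInCoord_le_area he.1 (B := e.symm '' (Metric.ball (0 : ℂ) R \ {0})) ?_ ?_
    · rwa [areaInCoord, himage] at this
    · rintro _ ⟨z, hz, rfl⟩
      exact ⟨he.symm_mem (hball hz.1) hz.2, e.map_target (hball hz.1)⟩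
    · rw [himage]
      exact measurableSet_ball.diff (measurableSet_singleton 0)

theorem IsCoordCentredAt.hasConicalSingularity [IsManifold 𝓘(ℂ) ω X]
    {g : ConformalMetric X Ω}
    {e : OpenPartialHomeomorph X ℂ} {p : X} (he : g.IsCoordCentredAt e p) {β : ℝ} (hβ : -1 < β)
    {v : ℂ → ℂ} (hv : AnalyticAt ℂ v 0) (hv0 : v 0 ≠ 0)
    (hev : ∀ᶠ z in 𝓝[≠] (0 : ℂ), Real.exp (g.logDensity e z) = ‖z‖ ^ β * ‖v z‖) :
    g.HasConicalSingularity p (2 * Real.pi * (β + 1)) := by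
  refine ⟨mul_pos Real.two_pi_pos (by linarith), ?_⟩
  -- The identity change of variable only shrinks the domain to where `v` is analytic and nonzero
  -- and the factorisation holds.
  obtain ⟨e', he', hz⟩ := he.exists_comp (w := fun z => z) analyticAt_id rfl (by simp)
    ((hv.eventually_analyticAt.and (hv.continuousAt.eventually_ne hv0)).and
      (eventually_nhdsWithin_iff.1 hev))
  refine ⟨e', he', fun z => Real.log ‖v z‖, fun z hz' => ?_, fun z hz' hz0 => ?_⟩
  · obtain ⟨_, -, rfl, ⟨⟨hva, hvn⟩, -⟩, -⟩ := hz z hz'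
    exact (hva.continuousAt.norm.log (norm_ne_zero_iff.2 hvn)).continuousWithinAt
  · obtain ⟨_, -, rfl, ⟨⟨-, hvn⟩, hexp⟩, hlog⟩ := hz z hz'
    have h1 := (hlog hz0).2
    rw [deriv_id'', norm_one, Real.log_one, add_zero] at h1
    have hzn : 0 < ‖z‖ := norm_pos_iff.2 hz0
    have h2 : g.logDensity e z = β * Real.log ‖z‖ + Real.log ‖v z‖ := by
      rw [← Real.log_exp (g.logDensity e z), hexp hz0, Real.log_mul
        (Real.rpow_pos_of_pos hzn _).ne' (norm_ne_zero_iff.2 hvn), Real.log_rpow hzn]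
    rw [← h1, h2, mul_div_cancel_left₀ _ Real.two_pi_pos.ne']
    ring

theorem IsCoordCentredAt.hasConeNormalForm [IsManifold 𝓘(ℂ) ω X]
    {g : ConformalMetric X Ω}
    {e : OpenPartialHomeomorph X ℂ} {p : X} (he : g.IsCoordCentredAt e p) {β : ℝ} (hβ : -1 < β)
    {v : ℂ → ℂ} (hv : AnalyticAt ℂ v 0) (hv0 : v 0 ≠ 0)
    (hev : ∀ᶠ z in 𝓝[≠] (0 : ℂ), Real.exp (g.logDensity e z) = ‖z‖ ^ β * ‖v z‖) :
    g.HasConeNormalForm p β := by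
  obtain ⟨w, hw, hw0, hw', hwv⟩ := exists_analyticAt_norm_rpow_mul_norm_deriv hβ hv hv0
  obtain ⟨e', he', hz⟩ := he.exists_comp hw hw0 hw'
    ((hwv.and (hw.deriv.continuousAt.eventually_ne hw')).and (eventually_nhdsWithin_iff.1 hev))
  refine ⟨e', he', fun y hy hy0 => ?_⟩
  obtain ⟨z, -, hyw, ⟨⟨hzv, hd⟩, hexp⟩, hlog⟩ := hz y hy
  obtain ⟨hz0, h1⟩ := hlog hy0
  have hdn : 0 < ‖deriv w z‖ := norm_pos_iff.2 hd
  have h2 := hexp hz0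
  -- Both expressions for the old density carry the factor `|w'(z)|`; cancelling it leaves `(β + 1)
  -- |y|^β`.
  rw [← hzv, h1, Real.exp_add, Real.exp_log hdn, mul_left_inj' hdn.ne', ← hyw] at h2
  rw [two_mul, Real.exp_add, h2, two_mul, Real.rpow_add (norm_pos_iff.2 hy0)]
  ring

end ConformalMetric

end RiemannSurface

theorem corollary1p5 {X : Type*} [TopologicalSpace X] [T2Space X] [ConnectedSpace X]
    [ChartedSpace ℂ X] [IsManifold 𝓘(ℂ) ω X]
    (Ω : TopologicalSpace.Opens X) (g : ConformalMetric X Ω)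
    (hflat : g.IsFlat) (harea : g.area < (⊤ : ℝ≥0∞))
    (p : X) (hp : g.IsIsolatedSingularity p) :
    ∃ β : ℝ, -1 < β ∧
      g.HasConicalSingularity p (2 * Real.pi * (β + 1)) ∧
      g.HasConeNormalForm p β := by
  obtain ⟨e, he⟩ := hp.exists_isCoordCentredAt
  obtain ⟨β, v, hβ, hv, hv0, hev⟩ := he.exists_exp_logDensity_eq hflat harea
  exact ⟨β, hβ, he.hasConicalSingularity hβ hv hv0 hev, he.hasConeNormalForm hβ hv hv0 hev⟩
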